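/- **Average MSE.** *Network.* Let access points (APs) form a homogeneous Poisson point process of density $\lambda>0$ in $\mathbb{R}^2$, and let $\lambda_u>0$ be the density of devices. The path loss between $X$ and $Y$ is $L(X,Y)=S_{X,Y}\|X-Y\|^4$, where the shadowing variables $S_{X,Y}>0$ are i.i.d.; the fading power gains $H_{X,Y}\sim\exp(1)$ are i.i.d. Each device is served by the AP of minimum path loss. The typical device, at the origin, is served by the AP $c_0$; write $L_0$ for its path loss to $c_0$. Devices use full path loss inversion and orthogonal access, and thermal noise is neglected ($\mathrm{SNR}=\infty$), so that the uplink SINR of the typical device is $$\mathrm{SINR}_u=\frac{H_{0,c_0}}{\mathrm{SNR}^{-1}+\sum_{X\in\Phi_u^b}L_XH_{X,c_0}L(X,c_0)^{-1}},$$ where $\Phi_u^b$ is the set of devices transmitting on the same resource and $L_X$ is the path loss of $X$ to its own serving AP. As is usual in the analysis of such uplinks, seen from $c_0$ the interfering devices with the marks $(S_{X,c_0},L_X,H_{X,c_0})$ are taken to form a Poisson process, independent of $H_{0,c_0}$: it is the homogeneous Poisson process of density $\lambda$ with independent marks distributed as the shadowing, as $L_0$, and as $\exp(1)$, restricted to the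 devices with $L_X\le L(X,c_0)$. The load of the AP $c_0$ is taken equal to its average $\bar L=1+1.28\,\lambda_u/\lambda$, the uplink rate is $\mathrm{Rate}_u=\frac{b}{\bar L}\log_2(1+\mathrm{SINR}_u)$ with bandwidth $b>0$, and the downlink rate $\mathrm{Rate}_d$ is taken equal to $\mathrm{Rate}_u$. *Inference.* Let $y,y_d,y_c$ be the true output and the outputs of the device and cloud models, with finite mean square errors $m_d=\mathbb{E}(y-y_d)^2$ and $m_c=\mathbb{E}(y-y_c)^2$, $m_c\le m_d$. Let $q>0$ be the total payload, $d_c\ge 0$ the compute delay of the cloud, $d_t>d_c$ the target delay, $D=\frac{q}{2\mathrm{Rate}_u}+\frac{q}{2\mathrm{Rate}_d}+d_c$ the cloud inference delay and $r_{\min}=\frac{q}{b(d_t-d_c)}$. The average inference MSE of the typical device is $\bar m=\mathbb{E}[\mathbf 1(D\le d_t)\,m_c]+\mathbb{E}[\mathbf 1(D>d_t)\,m_d]$. *Claim.* With $C(x)=\sqrt{x}\arctan\sqrt{x}$ and $T(x)=2^x-1$, $$\bar m=m_d-(m_d-m_c)\exp\bigl(-C(T(\bar L\,r_{\min}))\bigr),$$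 and consequently $m_c\le\bar m\le m_d$. -/

import Mathlib

open MeasureTheory ProbabilityTheory
open scoped ENNReal

noncomputable section

/-- The number `N(B)` of indices `n` such that the `n`-th point lies in `B`
(points are counted with multiplicity). -/
def pointCount {Ω E : Type*} (X : ℕ → Ω → E) (B : Set E) (ω : Ω) : ℕ∞ :=
  {n : ℕ | X n ω ∈ B}.encard

/-- The random points `X 0, X 1, …` form a Poisson point process with intensity measure `μ`
(necessarily of infinite total mass): the number of points in a measurable set `B` is
Poisson with mean `μ B` (almost surely infinite if `μ B = ∞`), and the numbers of points in
pairwise disjoint measurable sets are independent. -/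
structure IsPoissonProcess {Ω E : Type*} [MeasurableSpace Ω] [MeasurableSpace E]
    (P : Measure Ω) (X : ℕ → Ω → E) (μ : Measure E) : Prop where
  measurable : ∀ n, Measurable (X n)
  poisson : ∀ B : Set E, MeasurableSet B → μ B ≠ ∞ →
    ∀ k : ℕ, P {ω | pointCount X B ω = k} = poissonMeasure (μ B).toNNReal {k}
  infinite : ∀ B : Set E, MeasurableSet B → μ B = ∞ → ∀ᵐ ω ∂P, pointCount X B ω = ⊤
  indep : ∀ (m : ℕ) (B : Fin m → Set E), (∀ i, MeasurableSet (B i)) →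
    Pairwise (fun i j => Disjoint (B i) (B j)) →
    iIndepFun (fun i => pointCount X (B i)) P

/-- The plane in which access points (APs) and devices live. -/
abbrev Plane := EuclideanSpace ℝ (Fin 2)

/-- Path loss `L(X, Y) = S ‖X - Y‖ ^ 4` with large scale fading `S`. -/
def pathLoss (s : ℝ) (x y : Plane) : ℝ := s * ‖x - y‖ ^ 4

/-- Intensity of the interfering devices, seen from the AP serving the typical device. A device
is a tuple `(x, s, l, h)`: its position relative to that AP, the shadowing and
the fading power gain of the link to that AP, and the path loss `l` to its own serving AP.
There is one device per AP on each resource block (density `lam`), shadowing is distributed as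
`shadow`, fading as `exp(1)`, and `l` as the serving path loss of the typical device (law `ν`).
As devices use minimum path loss association, only those whose path loss to their own
AP does not exceed that to the AP of the typical device are kept. -/
def interfererIntensity (lam : ℝ) (shadow ν : Measure ℝ) : Measure (Plane × ℝ × ℝ × ℝ) :=
  ((ENNReal.ofReal lam • (volume : Measure Plane)).prod
    (shadow.prod (ν.prod (expMeasure 1)))).restrict
      {p | p.2.2.1 ≤ pathLoss p.2.1 p.1 0}

/-- The uplink of a cellular network with AP density `lam` and shadowing distribution `shadow`, as
seen by a typical device located at the origin. -/
structure UplinkNetwork {Ω : Type*} [MeasurableSpace Ω] (P : Measure Ω)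
    (lam : ℝ) (shadow : Measure ℝ) where
  /-- locations of the APs -/
  ap : ℕ → Ω → Plane
  /-- shadowing between the typical device and the APs -/
  apShadow : ℕ → Ω → ℝ
  /-- index of the AP serving the typical device -/
  serving : Ω → ℕ
  /-- fading power gain between the typical device and its serving AP -/
  fading : Ω → ℝ
  /-- locations of the devices transmitting on the same resource block as the typical one -/
  dev : ℕ → Ω → Plane
  /-- shadowing between these devices and the AP serving the typical device -/
  devShadow : ℕ → Ω → ℝ
  /-- path loss between these devices and their own serving APs -/
  devLoss : ℕ → Ω → ℝ
  /-- fading power gain between these devices and the AP serving the typical device -/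
  devFading : ℕ → Ω → ℝ
  /-- The APs form a homogeneous Poisson process of density `lam`, with i.i.d. shadowing. -/
  ap_poisson : IsPoissonProcess P (fun n ω => (ap n ω, apShadow n ω))
    ((ENNReal.ofReal lam • (volume : Measure Plane)).prod shadow)
  serving_measurable : Measurable serving
  /-- Minimum path loss association. -/
  serving_min : ∀ᵐ ω ∂P, ∀ n,
    pathLoss (apShadow (serving ω) ω) 0 (ap (serving ω) ω) ≤ pathLoss (apShadow n ω) 0 (ap n ω)
  /-- Rayleigh fading with unit average power. -/
  fading_law : HasLaw fading (expMeasure 1) P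
  /-- The interfering devices, seen from the serving AP, form a marked Poisson process. -/
  dev_poisson : IsPoissonProcess P
    (fun n ω => (dev n ω - ap (serving ω) ω, devShadow n ω, devLoss n ω, devFading n ω))
    (interfererIntensity lam shadow
      (P.map fun ω => pathLoss (apShadow (serving ω) ω) 0 (ap (serving ω) ω)))
  /-- The fading of the typical device is independent of the interfering devices. -/
  fading_indep : IndepFun fading (fun ω n =>
    (dev n ω - ap (serving ω) ω, devShadow n ω, devLoss n ω, devFading n ω)) P

namespace UplinkNetwork

variable {Ω : Type*} [MeasurableSpace Ω] {P : Measure Ω} {lam : ℝ} {shadow : Measure ℝ}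

/-- Location `c₀` of the AP serving the typical device. -/
def servingAP (U : UplinkNetwork P lam shadow) (ω : Ω) : Plane := U.ap (U.serving ω) ω

/-- Uplink interference `∑ L_X H_{X,c₀} / L(X, c₀)` over the interfering devices `X`. -/
def interference (U : UplinkNetwork P lam shadow) (ω : Ω) : ℝ≥0∞ :=
  ∑' n, ENNReal.ofReal (U.devLoss n ω * U.devFading n ω *
    (pathLoss (U.devShadow n ω) (U.dev n ω) (U.servingAP ω))⁻¹)

/-- Uplink SINR of the typical device, with full path loss inversion; `snr = ∞` means that
thermal noise is absent. -/
def sinr (U : UplinkNetwork P lam shadow) (snr : ℝ≥0∞) (ω : Ω) : ℝ≥0∞ :=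
  ENNReal.ofReal (U.fading ω) / (snr⁻¹ + U.interference ω)

/-- Uplink rate `(b / N) log₂ (1 + SINR)` of the typical device with bandwidth `b`, when its
AP serves `N` devices. -/
def rate (U : UplinkNetwork P lam shadow) (snr : ℝ≥0∞) (b : ℝ) (N : Ω → ℝ) (ω : Ω) : ℝ≥0∞ :=
  ENNReal.ofReal (b / N ω) *
    ((ENNReal.log (1 + U.sinr snr ω)).toENNReal / ENNReal.ofReal (Real.log 2))

end UplinkNetwork

/-- Average load `1 + 1.28 / (lam / lamu)` of the serving AP, for AP density `lam` and device density
`lamu`. -/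
def avgLoad (lam lamu : ℝ) : ℝ := 1 + 1.28 / (lam / lamu)

/-- Inference rate `q / (b (d_t - d_c))`. -/
def inferenceRate (q b dt dc : ℝ) : ℝ := q / (b * (dt - dc))

/-- Cloud inference delay `q / (2 R_u) + q / (2 R_d) + d_c` (infinite if a rate vanishes). -/
def cloudDelay (q dc : ℝ) (ru rd : ℝ≥0∞) : ℝ≥0∞ :=
  ENNReal.ofReal q / (2 * ru) + ENNReal.ofReal q / (2 * rd) + ENNReal.ofReal dc

/-- Mean square error of the prediction `z` of `y` under the data distribution `Q`. -/
def mse {Θ : Type*} [MeasurableSpace Θ] (Q : Measure Θ) (y z : Θ → ℝ) : ℝ :=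
  ∫ θ, (y θ - z θ) ^ 2 ∂Q

/-- Average inference MSE `E[1(D ≤ d_t) m_c] + E[1(D > d_t) m_d]`. -/
def averageMSE {Ω : Type*} [MeasurableSpace Ω] (P : Measure Ω) (D : Ω → ℝ≥0∞)
    (dt mc md : ℝ) : ℝ :=
  (∫ ω, {ω | D ω ≤ ENNReal.ofReal dt}.indicator (fun _ => mc) ω ∂P) +
    ∫ ω, {ω | ENNReal.ofReal dt < D ω}.indicator (fun _ => md) ω ∂P

/-- `C(x) = √x arctan √x` -/
def covC (x : ℝ) : ℝ := Real.sqrt x * Real.arctan (Real.sqrt x)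

/-- `T(x) = 2 ^ x - 1` -/
def rateT (x : ℝ) : ℝ := (2 : ℝ) ^ x - 1

end

/-! Both links carry half the payload at the same rate, so `D ≤ d_t` says that the rate is at least
`q / (d_t - d_c)`, that is, `SINR ≥ T` with `T = T(L̄ r_min)`. Hence `m̄ = m_d - (m_d - m_c) P(SINR
≥ T)`, and a coverage probability remains to be computed.

Without noise, `SINR ≥ T` means `H ≥ T I`. As `H ~ exp(1)` is independent of the interference `I`,
the probability is `E e^(-T I)`, which the Laplace functional of a Poisson process
(`lintegral_negExp_tsum`) turns into `exp(-∫ (1 - e^(-f)))`.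

To find the exponent, put `u = √(path loss)`. Path loss grows like `r ^ 4` and area like `r ^ 2`, so
under any shadowing the points have constant intensity `κ du` (`lintegral_comp_pathLoss`). An
interferer with own loss `l` has `u ≥ √l` and, averaged over fading, contributes `Tl / (Tl + u ^
2)`; the integral over `u` is `√l C(T)`. The exponent is thus `κ E[√L₀] C(T)`
(`lintegral_interfererIntensity`).

Finally `√L₀` is exponential of rate `κ`, by the void probability of the APs. So `κ E[√L₀] = 1`:
density and shadowing cancel. -/

open MeasureTheory ProbabilityTheory
open scoped ENNReal

/-! ### The exponential on `[0, ∞]` -/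

/-- The function `x ↦ e⁻ˣ` on `[0, ∞]`, with `e^(-∞) = 0`. -/
noncomputable def negExp (x : ℝ≥0∞) : ℝ≥0∞ := EReal.exp (-(x : EReal))

@[simp] lemma negExp_zero : negExp 0 = 1 := by simp [negExp]

@[simp] lemma negExp_top : negExp ∞ = 0 := by simp [negExp]

lemma negExp_ofReal {x : ℝ} (hx : 0 ≤ x) :
    negExp (ENNReal.ofReal x) = ENNReal.ofReal (Real.exp (-x)) := by
  rw [negExp, EReal.coe_ennreal_ofReal, max_eq_left hx, ← EReal.coe_neg, EReal.exp_coe]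

lemma negExp_add (x y : ℝ≥0∞) : negExp (x + y) = negExp x * negExp y := by
  rw [negExp, negExp, negExp, ← EReal.exp_add, EReal.coe_ennreal_add, EReal.neg_add, sub_eq_add_neg]
  · left; simp
  · right; simp

lemma negExp_sum {ι : Type*} (s : Finset ι) (f : ι → ℝ≥0∞) :
    negExp (∑ i ∈ s, f i) = ∏ i ∈ s, negExp (f i) := by
  classical
  induction s using Finset.induction_on with
  | empty => simp
  | insert a s ha ih => rw [Finset.sum_insert ha, Finset.prod_insert ha, negExp_add, ih]

lemma negExp_mul_natCast (x : ℝ≥0∞) (k : ℕ) : negExp (x * k) = negExp x ^ k := by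
  rw [show x * (k : ℝ≥0∞) = ∑ _i ∈ Finset.range k, x by simp [mul_comm], negExp_sum]
  simp

lemma continuous_negExp : Continuous negExp :=
  ENNReal.continuous_exp.comp (continuous_neg.comp continuous_coe_ennreal_ereal)

lemma measurable_negExp : Measurable negExp := continuous_negExp.measurable

lemma negExp_antitone : Antitone negExp := fun _ _ h =>
  EReal.exp_monotone (EReal.neg_le_neg_iff.2 (EReal.coe_ennreal_le_coe_ennreal_iff.2 h))

lemma negExp_le_one (x : ℝ≥0∞) : negExp x ≤ 1 := by
  simpa using negExp_antitone (zero_le (a := x))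

lemma negExp_eq_one_iff {x : ℝ≥0∞} : negExp x = 1 ↔ x = 0 := by
  refine ⟨fun h => ?_, fun h => by simp [h]⟩
  have := EReal.one_le_exp_iff.1 h.ge
  have h0 := EReal.le_neg_of_le_neg this
  rw [neg_zero] at h0
  exact le_antisymm (by exact_mod_cast h0) zero_le

lemma monotone_one_sub_negExp : Monotone fun x => 1 - negExp x :=
  fun _ _ h => tsub_le_tsub_left (negExp_antitone h) 1

/-! ### Poisson processes: counts and the Laplace functional -/

lemma pointCount_eq_tsum {Ω E : Type*} (X : ℕ → Ω → E) (B : Set E) (ω : Ω) :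
    ((pointCount X B ω : ℕ∞) : ℝ≥0∞) = ∑' n, B.indicator 1 (X n ω) := by
  have h : Measure.count {n : ℕ | X n ω ∈ B} = ((pointCount X B ω : ℕ∞) : ℝ≥0∞) :=
    Measure.count_apply .of_discrete
  rw [← h, ← lintegral_indicator_one .of_discrete, lintegral_count]
  rfl

lemma measurable_pointCount {Ω E : Type*} [MeasurableSpace Ω] [MeasurableSpace E]
    {X : ℕ → Ω → E} (hX : ∀ n, Measurable (X n)) {B : Set E} (hB : MeasurableSet B) :
    Measurable (pointCount X B) := by
  have h : Measurable fun ω => ((pointCount X B ω : ℕ∞) : ℝ≥0∞) := by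
    simp only [pointCount_eq_tsum]
    exact Measurable.tsum fun n => (measurable_one.indicator hB).comp (hX n)
  refine measurable_to_countable' fun k => ?_
  have : pointCount X B ⁻¹' {k} =
      (fun ω => ((pointCount X B ω : ℕ∞) : ℝ≥0∞)) ⁻¹' {(k : ℝ≥0∞)} := by
    ext ω; simp
  rw [this]
  exact h (measurableSet_singleton _)

lemma tsum_simpleFunc_eq {Ω E : Type*} [MeasurableSpace E] (X : ℕ → Ω → E)
    (f : SimpleFunc E ℝ≥0∞) (ω : Ω) :
    ∑' n, f (X n ω) = ∑ a ∈ f.range, a * (pointCount X (f ⁻¹' {a}) ω : ℕ∞) := by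
  simp only [pointCount_eq_tsum, ← ENNReal.tsum_mul_left]
  rw [← Summable.tsum_finsetSum fun _ _ => ENNReal.summable]
  refine tsum_congr fun n => ?_
  rw [Finset.sum_eq_single (f (X n ω))]
  · simp
  · intro a _ ha
    simp [Set.indicator, ha.symm]
  · simp

namespace IsPoissonProcess

variable {Ω E : Type*} [MeasurableSpace Ω] [MeasurableSpace E] {P : Measure Ω}
  {X : ℕ → Ω → E} {μ : Measure E}

lemma measure_pointCount_eq_zero [IsProbabilityMeasure P] (h : IsPoissonProcess P X μ)
    {B : Set E} (hB : MeasurableSet B) :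
    P {ω | pointCount X B ω = 0} = negExp (μ B) := by
  by_cases hμ : μ B = ∞
  · rw [hμ, negExp_top]
    have := h.infinite B hB hμ
    refine measure_mono_null (fun ω hω => ?_) this
    simp only [Set.mem_ofPred_eq] at hω
    simp [hω]
  · have := h.poisson B hB hμ 0
    rw [Nat.cast_zero] at this
    rw [this, poissonMeasure_singleton]
    conv_rhs => rw [← ENNReal.ofReal_toReal hμ, negExp_ofReal ENNReal.toReal_nonneg]
    simp [ENNReal.coe_toNNReal_eq_toReal]

/-- This is the Poisson generating function `E w ^ N = e^(-(1 - w) μ(B))` at `w = e^(-a)`. If `μ B =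
∞`, both sides are `1` for `a = 0` and `0` otherwise. -/
lemma lintegral_negExp_mul_pointCount [IsProbabilityMeasure P] (h : IsPoissonProcess P X μ)
    {B : Set E} (hB : MeasurableSet B) (a : ℝ≥0∞) :
    ∫⁻ ω, negExp (a * (pointCount X B ω : ℕ∞)) ∂P = negExp ((1 - negExp a) * μ B) := by
  by_cases hμ : μ B = ∞
  · have : ∀ᵐ ω ∂P, negExp (a * (pointCount X B ω : ℕ∞)) = negExp (a * ∞) := by
      filter_upwards [h.infinite B hB hμ] with ω hω
      simp [hω]
    rw [lintegral_congr_ae this, hμ]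
    rcases eq_or_ne a 0 with rfl | ha
    · simp
    · have h1 : 1 - negExp a ≠ 0 := by
        rw [Ne, tsub_eq_zero_iff_le, not_le]
        exact lt_of_le_of_ne (negExp_le_one a) (negExp_eq_one_iff.not.2 ha)
      simp [ENNReal.mul_top ha, ENNReal.mul_top h1]
  · set r := (μ B).toNNReal with hr
    have hmeas := measurable_pointCount h.measurable hB
    have hmap : P.map (pointCount X B) = (poissonMeasure r).map (fun k : ℕ => (k : ℕ∞)) := by
      have hk : ∀ k : ℕ, P.map (pointCount X B) {(k : ℕ∞)} =
          (poissonMeasure r).map (fun k : ℕ => (k : ℕ∞)) {(k : ℕ∞)} := fun k => by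
        rw [Measure.map_apply hmeas (measurableSet_singleton _),
          Measure.map_apply .of_discrete (measurableSet_singleton _)]
        have h1 : (fun k : ℕ => (k : ℕ∞)) ⁻¹' {(k : ℕ∞)} = {k} := by ext; simp
        rw [h1]
        exact h.poisson B hB hμ k
      have : IsProbabilityMeasure (P.map (pointCount X B)) :=
        Measure.isProbabilityMeasure_map hmeas.aemeasurable
      have : IsProbabilityMeasure ((poissonMeasure r).map (fun k : ℕ => (k : ℕ∞))) :=
        Measure.isProbabilityMeasure_map Measurable.of_discrete.aemeasurable
      refine Measure.ext_of_singleton fun k => ?_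
      induction k using ENat.recTopCoe with
      | coe k => exact hk k
      -- Only the finite values have prescribed masses; total mass one on both sides settles the
      -- mass at `⊤`.
      | top =>
        have hc : ({⊤} : Set ℕ∞) = (⋃ k : ℕ, {(k : ℕ∞)})ᶜ := by
          ext x
          induction x using ENat.recTopCoe <;> simp
        have hd : Pairwise (Function.onFun Disjoint fun k : ℕ => ({(k : ℕ∞)} : Set ℕ∞)) := by
          intro i j hij
          simpa [Function.onFun] using hij
        rw [hc, prob_compl_eq_one_sub .of_discrete, prob_compl_eq_one_sub .of_discrete,
          measure_iUnion hd fun _ => .of_discrete, measure_iUnion hd fun _ => .of_discrete]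
        simp_rw [hk]
    have hlaw : ∫⁻ ω, negExp (a * (pointCount X B ω : ℕ∞)) ∂P =
        ∫⁻ k : ℕ, negExp a ^ k ∂poissonMeasure r := by
      rw [← lintegral_map (f := fun x : ℕ∞ => negExp (a * x)) .of_discrete hmeas, hmap,
        lintegral_map .of_discrete .of_discrete]
      exact lintegral_congr fun k => by simp [negExp_mul_natCast]
    have hw : negExp a ≠ ∞ := ((negExp_le_one a).trans_lt ENNReal.one_lt_top).ne
    obtain ⟨w, hw0, hwa⟩ : ∃ w : ℝ, 0 ≤ w ∧ negExp a = ENNReal.ofReal w :=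
      ⟨_, ENNReal.toReal_nonneg, (ENNReal.ofReal_toReal hw).symm⟩
    have hw1 : w ≤ 1 := by
      have := negExp_le_one a
      rwa [hwa, ENNReal.ofReal_le_one] at this
    have hμr : μ B = ENNReal.ofReal r := by
      rw [hr, ENNReal.ofReal_coe_nnreal, ENNReal.coe_toNNReal hμ]
    rw [hlaw, lintegral_countable', hwa, hμr, ← ENNReal.ofReal_one, ← ENNReal.ofReal_sub _ hw0,
      ← ENNReal.ofReal_mul (sub_nonneg.2 hw1),
      negExp_ofReal (mul_nonneg (sub_nonneg.2 hw1) r.coe_nonneg)]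
    have hs : HasSum (fun k : ℕ => Real.exp (-r) * ((w * r) ^ k / k.factorial))
        (Real.exp (-r) * Real.exp (w * r)) := by
      have := NormedSpace.expSeries_div_hasSum_exp (𝔸 := ℝ) (w * r)
      rw [← Real.exp_eq_exp_ℝ] at this
      exact this.mul_left _
    rw [show -((1 - w) * (r : ℝ)) = -r + w * r by ring, Real.exp_add, ← hs.tsum_eq,
      ENNReal.ofReal_tsum_of_nonneg (fun k => by positivity) hs.summable]
    refine tsum_congr fun k => ?_
    rw [poissonMeasure_singleton, ← ENNReal.ofReal_pow hw0, ← ENNReal.ofReal_mul (by positivity)]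
    congr 1
    rw [mul_pow]
    ring

/-- The sum is a linear combination of the counts in the fibres of `f`. These are disjoint, so the
counts are independent and the expectation factorises. -/
lemma lintegral_negExp_tsum_simpleFunc [IsProbabilityMeasure P] (h : IsPoissonProcess P X μ)
    (f : SimpleFunc E ℝ≥0∞) :
    ∫⁻ ω, negExp (∑' n, f (X n ω)) ∂P = negExp (∫⁻ x, (1 - negExp (f x)) ∂μ) := by
  set e := f.range.equivFin
  set B : Fin f.range.card → Set E := fun i => f ⁻¹' {((e.symm i : f.range) : ℝ≥0∞)}
  have hB : ∀ i, MeasurableSet (B i) := fun i => f.measurableSet_fiber _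
  have hd : Pairwise fun i j => Disjoint (B i) (B j) := fun i j hij => by
    refine Disjoint.preimage _ (Set.disjoint_singleton.2 fun hc => hij ?_)
    exact e.symm.injective (Subtype.ext hc)
  have hsum : ∀ g : ℝ≥0∞ → ℝ≥0∞, ∑ a ∈ f.range, g a =
      ∑ i, g ((e.symm i : f.range) : ℝ≥0∞) := fun g => by
    rw [← Finset.sum_coe_sort, ← e.symm.sum_comp]
  have hind := h.indep _ B hB hd
  have hind' : iIndepFun (fun i ω => negExp
      (((e.symm i : f.range) : ℝ≥0∞) * (pointCount X (B i) ω : ℕ∞))) P :=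
    hind.comp (fun i (k : ℕ∞) => negExp (((e.symm i : f.range) : ℝ≥0∞) * (k : ℝ≥0∞)))
      fun i => .of_discrete
  have hmeas : ∀ i, Measurable fun ω => negExp
      (((e.symm i : f.range) : ℝ≥0∞) * (pointCount X (B i) ω : ℕ∞)) := fun i =>
    (Measurable.of_discrete (f := fun k : ℕ∞ =>
      negExp (((e.symm i : f.range) : ℝ≥0∞) * (k : ℝ≥0∞)))).comp
      (measurable_pointCount h.measurable (hB i))
  calc ∫⁻ ω, negExp (∑' n, f (X n ω)) ∂P
      = ∫⁻ ω, ∏ i, negExp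
          (((e.symm i : f.range) : ℝ≥0∞) * (pointCount X (B i) ω : ℕ∞)) ∂P := by
        refine lintegral_congr fun ω => ?_
        rw [tsum_simpleFunc_eq, hsum fun a => a * (pointCount X (f ⁻¹' {a}) ω : ℕ∞), negExp_sum]
    _ = ∏ i, ∫⁻ ω, negExp
          (((e.symm i : f.range) : ℝ≥0∞) * (pointCount X (B i) ω : ℕ∞)) ∂P :=
        lintegral_prod_eq_prod_lintegral_of_indepFun Finset.univ _ hind' hmeas
    _ = negExp (∑ a ∈ f.range, (1 - negExp a) * μ (f ⁻¹' {a})) := by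
        simp_rw [h.lintegral_negExp_mul_pointCount (hB _)]
        rw [hsum fun a => (1 - negExp a) * μ (f ⁻¹' {a}), negExp_sum]
    _ = _ := by
        rw [← SimpleFunc.map_lintegral (g := fun x => 1 - negExp x),
          ← SimpleFunc.lintegral_eq_lintegral]
        rfl

/-- The Laplace functional of a Poisson process. -/
theorem lintegral_negExp_tsum [IsProbabilityMeasure P] (h : IsPoissonProcess P X μ)
    {f : E → ℝ≥0∞} (hf : Measurable f) :
    ∫⁻ ω, negExp (∑' n, f (X n ω)) ∂P = negExp (∫⁻ x, (1 - negExp (f x)) ∂μ) := by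
  have hlim : ∀ x, Filter.Tendsto (fun k => SimpleFunc.eapprox f k x) Filter.atTop (nhds (f x)) :=
    fun x => by
      rw [← SimpleFunc.iSup_eapprox_apply hf x]
      exact tendsto_atTop_iSup fun i j hij => SimpleFunc.monotone_eapprox f hij x
  -- Passage from simple functions to `f`: on the probability side by domination by `1`, on the
  -- intensity side by monotone convergence.
  have h1 : Filter.Tendsto (fun k => ∫⁻ ω, negExp (∑' n, SimpleFunc.eapprox f k (X n ω)) ∂P)
      Filter.atTop (nhds (∫⁻ ω, negExp (∑' n, f (X n ω)) ∂P)) := by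
    refine tendsto_lintegral_of_dominated_convergence (fun _ => 1) (fun k => ?_)
      (fun k => .of_forall fun ω => negExp_le_one _) (by simp) (.of_forall fun ω => ?_)
    · exact measurable_negExp.comp (Measurable.tsum fun n =>
        (SimpleFunc.measurable _).comp (h.measurable n))
    · refine (continuous_negExp.tendsto _).comp ?_
      -- As an integral against counting measure, the sum over points obeys monotone convergence.
      simp_rw [← lintegral_count]
      exact lintegral_tendsto_of_tendsto_of_monotone (fun _ => .of_discrete)
        (.of_forall fun n i j hij => SimpleFunc.monotone_eapprox f hij _)
        (.of_forall fun n => hlim _)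
  have h2 : Filter.Tendsto (fun k => negExp (∫⁻ x, (1 - negExp (SimpleFunc.eapprox f k x)) ∂μ))
      Filter.atTop (nhds (negExp (∫⁻ x, (1 - negExp (f x)) ∂μ))) := by
    refine (continuous_negExp.tendsto _).comp ?_
    refine lintegral_tendsto_of_tendsto_of_monotone (fun k => ?_)
      (.of_forall fun x i j hij => monotone_one_sub_negExp (SimpleFunc.monotone_eapprox f hij x))
      (.of_forall fun x => ?_)
    · exact (measurable_const.sub (measurable_negExp.comp (SimpleFunc.measurable _))).aemeasurable
    · exact ENNReal.Tendsto.sub tendsto_const_nhds ((continuous_negExp.tendsto _).comp (hlim x))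
        (.inl ENNReal.one_ne_top)
  simp_rw [h.lintegral_negExp_tsum_simpleFunc] at h1
  exact tendsto_nhds_unique h1 h2

end IsPoissonProcess

/-! ### Path losses as a process on the half-line -/

/-- The disc `c ‖x‖ ^ 2 ≤ b` has area `π b / c`, which is linear in `b`. -/
lemma map_mul_norm_sq_volume {c : ℝ} (hc : 0 < c) :
    (volume : Measure Plane).map (fun x => c * ‖x‖ ^ 2) =
      ENNReal.ofReal (Real.pi / c) • (volume : Measure ℝ).restrict (Set.Ioi 0) := by
  have hm : Measurable fun x : Plane => c * ‖x‖ ^ 2 := by fun_prop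
  have hIic : ∀ b : ℝ, (volume : Measure Plane).map (fun x => c * ‖x‖ ^ 2) (Set.Iic b) =
      ENNReal.ofReal (Real.pi / c) * ENNReal.ofReal b := fun b => by
    rw [Measure.map_apply hm measurableSet_Iic]
    rcases lt_or_ge b 0 with hb | hb
    · have : (fun x : Plane => c * ‖x‖ ^ 2) ⁻¹' Set.Iic b = ∅ := by
        ext x
        have : 0 ≤ c * ‖x‖ ^ 2 := by positivity
        simpa using hb.trans_le this
      rw [this, ENNReal.ofReal_of_nonpos hb.le]
      simp
    · have : (fun x : Plane => c * ‖x‖ ^ 2) ⁻¹' Set.Iic b = Metric.closedBall 0 (√(b / c)) := by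
        ext x
        rw [mem_closedBall_zero_iff, Real.le_sqrt (norm_nonneg x) (by positivity), le_div_iff₀' hc]
        rfl
      rw [this, EuclideanSpace.volume_closedBall_fin_two, ← ENNReal.ofReal_pow (Real.sqrt_nonneg _),
        Real.sq_sqrt (by positivity), ← ENNReal.ofReal_mul (by positivity),
        ← ENNReal.ofReal_mul (by positivity)]
      congr 1
      ring
  have hIic' : ∀ b : ℝ, (ENNReal.ofReal (Real.pi / c) •
      (volume : Measure ℝ).restrict (Set.Ioi 0)) (Set.Iic b) =
      ENNReal.ofReal (Real.pi / c) * ENNReal.ofReal b := fun b => by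
    rw [Measure.smul_apply, Measure.restrict_apply measurableSet_Iic, Set.Iic_inter_Ioi,
      Real.volume_Ioc, sub_zero, smul_eq_mul]
  have : IsLocallyFiniteMeasure (ENNReal.ofReal (Real.pi / c) •
      (volume : Measure ℝ).restrict (Set.Ioi 0)) :=
    inferInstanceAs (IsLocallyFiniteMeasure ((Real.pi / c).toNNReal •
      (volume : Measure ℝ).restrict (Set.Ioi 0)))
  refine (Measure.ext_of_Ioc _ _ fun a b hab => ?_).symm
  rw [← Set.Iic_sdiff_Iic, measure_sdiff (Set.Iic_subset_Iic.2 hab.le)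
    measurableSet_Iic.nullMeasurableSet, measure_sdiff (Set.Iic_subset_Iic.2 hab.le)
    measurableSet_Iic.nullMeasurableSet, hIic, hIic, hIic', hIic']
  · rw [hIic]; exact ENNReal.mul_ne_top ENNReal.ofReal_ne_top ENNReal.ofReal_ne_top
  · rw [hIic']; exact ENNReal.mul_ne_top ENNReal.ofReal_ne_top ENNReal.ofReal_ne_top

/-- The number `κ` such that the mean number of points of path loss at most `u ^ 2` is `κ u`, for
points of density `lam`. -/
noncomputable def pathLossRate (lam : ℝ) (shadow : Measure ℝ) : ℝ≥0∞ :=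
  ENNReal.ofReal lam * ∫⁻ s, ENNReal.ofReal (Real.pi / √s) ∂shadow

lemma pathLoss_comm (s : ℝ) (x y : Plane) : pathLoss s x y = pathLoss s y x := by
  rw [pathLoss, pathLoss, norm_sub_rev]

lemma measurable_pathLoss_zero : Measurable fun p : Plane × ℝ => pathLoss p.2 p.1 0 := by
  unfold pathLoss; fun_prop

/-- The path losses of the points of a marked homogeneous process have intensity `κ du` in the
variable `u = √(path loss)`. -/
lemma lintegral_comp_pathLoss {shadow : Measure ℝ} [IsProbabilityMeasure shadow]
    (hshadow : ∀ᵐ s ∂shadow, 0 < s) (lam : ℝ) {g : ℝ → ℝ≥0∞} (hg : Measurable g) :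
    ∫⁻ p, g (pathLoss p.2 p.1 0) ∂((ENNReal.ofReal lam • (volume : Measure Plane)).prod shadow) =
      pathLossRate lam shadow * ∫⁻ u in Set.Ioi 0, g (u ^ 2) := by
  rw [lintegral_prod_symm' (fun p : Plane × ℝ => g (pathLoss p.2 p.1 0))
    (hg.comp measurable_pathLoss_zero), pathLossRate, mul_assoc,
    ← lintegral_mul_const _ (by fun_prop), ← lintegral_const_mul _ (by fun_prop)]
  refine lintegral_congr_ae ?_
  filter_upwards [hshadow] with s hs
  -- For fixed shadowing `s`, the root of the path loss is `√s ‖x‖ ^ 2`, whose intensity is `π / √s`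
  -- per unit density.
  have h : ∀ x : Plane, pathLoss s x 0 = (√s * ‖x‖ ^ 2) ^ 2 := fun x => by
    rw [pathLoss, sub_zero, mul_pow, Real.sq_sqrt hs.le]; ring
  simp_rw [h]
  have hg' : Measurable fun u : ℝ => g (u ^ 2) := by fun_prop
  rw [lintegral_smul_measure, smul_eq_mul,
    ← lintegral_map (f := fun u : ℝ => g (u ^ 2)) hg' (by fun_prop),
    map_mul_norm_sq_volume (Real.sqrt_pos.2 hs), lintegral_smul_measure, smul_eq_mul]

lemma pathLossRate_ne_zero {shadow : Measure ℝ} [IsProbabilityMeasure shadow]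
    (hshadow : ∀ᵐ s ∂shadow, 0 < s) {lam : ℝ} (hlam : 0 < lam) :
    pathLossRate lam shadow ≠ 0 := by
  refine mul_ne_zero (by simpa using hlam) fun h => ?_
  rw [lintegral_eq_zero_iff (by fun_prop)] at h
  have : ∀ᵐ s ∂shadow, False := by
    filter_upwards [hshadow, h] with s hs h0
    have : 0 < Real.pi / √s := by positivity
    simp only [Pi.zero_apply, ENNReal.ofReal_eq_zero] at h0
    linarith
  simpa using this.exists

lemma measure_pathLoss_le {shadow : Measure ℝ} [IsProbabilityMeasure shadow]
    (hshadow : ∀ᵐ s ∂shadow, 0 < s) (lam : ℝ) {t : ℝ} (ht : 0 ≤ t) :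
    ((ENNReal.ofReal lam • (volume : Measure Plane)).prod shadow)
      {p | pathLoss p.2 p.1 0 ≤ t ^ 2} = pathLossRate lam shadow * ENNReal.ofReal t := by
  have h := lintegral_comp_pathLoss hshadow lam
    (g := (Set.Iic (t ^ 2)).indicator 1) (measurable_one.indicator measurableSet_Iic)
  have h1 : ∀ p : Plane × ℝ, (Set.Iic (t ^ 2)).indicator (1 : ℝ → ℝ≥0∞) (pathLoss p.2 p.1 0) =
      {p : Plane × ℝ | pathLoss p.2 p.1 0 ≤ t ^ 2}.indicator 1 p := fun p => rfl
  have h2 : ∫⁻ u in Set.Ioi (0 : ℝ), (Set.Iic (t ^ 2)).indicator (1 : ℝ → ℝ≥0∞) (u ^ 2) =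
      ENNReal.ofReal t := by
    have : ∀ u ∈ Set.Ioi (0 : ℝ), (Set.Iic (t ^ 2)).indicator (1 : ℝ → ℝ≥0∞) (u ^ 2) =
        (Set.Iic t).indicator 1 u := fun u hu => by
      simp only [Set.indicator, Set.mem_Iic, sq_le_sq₀ (le_of_lt hu) ht]
      rfl
    rw [setLIntegral_congr_fun measurableSet_Ioi this, lintegral_indicator_one measurableSet_Iic,
      Measure.restrict_apply measurableSet_Iic, Set.Iic_inter_Ioi, Real.volume_Ioc, sub_zero]
  have h3 : MeasurableSet {p : Plane × ℝ | pathLoss p.2 p.1 0 ≤ t ^ 2} :=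
    measurable_pathLoss_zero measurableSet_Iic
  simp_rw [h1] at h
  rwa [lintegral_indicator_one h3, h2] at h

/-! ### The law of the serving path loss -/

namespace UplinkNetwork

variable {Ω : Type*} [MeasurableSpace Ω] {P : Measure Ω} {lam : ℝ} {shadow : Measure ℝ}

/-- Path loss `L₀` of the typical device to its serving AP. -/
noncomputable def servingLoss (U : UplinkNetwork P lam shadow) (ω : Ω) : ℝ :=
  pathLoss (U.apShadow (U.serving ω) ω) 0 (U.ap (U.serving ω) ω)

lemma measurable_servingLoss (U : UplinkNetwork P lam shadow) : Measurable U.servingLoss := by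
  -- The serving index is random, so joint measurability in index and outcome is needed; the index
  -- set is countable.
  have h : Measurable fun q : ℕ × Ω => pathLoss (U.apShadow q.1 q.2) 0 (U.ap q.1 q.2) := by
    refine measurable_from_prod_countable_right fun n => ?_
    simp only [pathLoss_comm _ 0]
    exact measurable_pathLoss_zero.comp (U.ap_poisson.measurable n)
  exact h.comp (U.serving_measurable.prodMk measurable_id)

/-- By minimality, `L₀ > t ^ 2` holds exactly when no AP has path loss at most `t ^ 2`, so this is a
void probability. It makes `√L₀` exponential of rate `κ`. -/
lemma measure_sq_lt_servingLoss [IsProbabilityMeasure P] [IsProbabilityMeasure shadow]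
    (hshadow : ∀ᵐ s ∂shadow, 0 < s) (U : UplinkNetwork P lam shadow) {t : ℝ} (ht : 0 ≤ t) :
    P {ω | t ^ 2 < U.servingLoss ω} = negExp (pathLossRate lam shadow * ENNReal.ofReal t) := by
  have hB : MeasurableSet {p : Plane × ℝ | pathLoss p.2 p.1 0 ≤ t ^ 2} :=
    measurable_pathLoss_zero measurableSet_Iic
  rw [← measure_pathLoss_le hshadow lam ht, ← U.ap_poisson.measure_pointCount_eq_zero hB]
  refine measure_congr ?_
  filter_upwards [U.serving_min] with ω hω
  refine propext ?_
  change t ^ 2 < U.servingLoss ω ↔ Set.encard _ = 0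
  rw [Set.encard_eq_zero, Set.eq_empty_iff_forall_notMem]
  refine ⟨fun h n hn => ?_, fun h => ?_⟩
  · have hn' : pathLoss (U.apShadow n ω) (U.ap n ω) 0 ≤ t ^ 2 := hn
    rw [pathLoss_comm] at hn'
    exact (h.trans_le ((hω n).trans hn')).false
  · by_contra hlt
    refine h (U.serving ω) ?_
    change pathLoss (U.apShadow _ ω) (U.ap _ ω) 0 ≤ t ^ 2
    rw [pathLoss_comm]
    exact not_lt.1 hlt

lemma ae_servingLoss_pos [IsProbabilityMeasure P] [IsProbabilityMeasure shadow]
    (hshadow : ∀ᵐ s ∂shadow, 0 < s) (U : UplinkNetwork P lam shadow) :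
    ∀ᵐ ω ∂P, 0 < U.servingLoss ω := by
  -- At `t = 0` the exponent `κ * 0` vanishes even if `κ = ∞`, so finiteness of `κ` is not needed
  -- yet.
  have h := U.measure_sq_lt_servingLoss hshadow le_rfl
  simp only [ne_eq, OfNat.ofNat_ne_zero, not_false_eq_true, zero_pow, ENNReal.ofReal_zero, mul_zero,
    negExp_zero] at h
  exact (mem_ae_iff_prob_eq_one (U.measurable_servingLoss measurableSet_Ioi)).2 h

/-- Existence of an AP of minimum path loss forces this: if `κ = ∞`, points of arbitrarily small
path loss exist almost surely, so `L₀ ≤ 0`, against `L₀ > 0`. -/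
lemma pathLossRate_ne_top [IsProbabilityMeasure P] [IsProbabilityMeasure shadow]
    (hshadow : ∀ᵐ s ∂shadow, 0 < s) (U : UplinkNetwork P lam shadow) :
    pathLossRate lam shadow ≠ ∞ := by
  intro htop
  have h : ∀ k : ℕ, ∀ᵐ ω ∂P, ¬ (1 / ((k : ℝ) + 1)) ^ 2 < U.servingLoss ω := fun k => by
    have hk : 0 < 1 / ((k : ℝ) + 1) := by positivity
    have := U.measure_sq_lt_servingLoss hshadow hk.le
    rw [htop, ENNReal.top_mul (by simpa using hk), negExp_top] at this
    exact measure_eq_zero_iff_ae_notMem.1 this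
  have : ∀ᵐ ω ∂P, False := by
    filter_upwards [ae_all_iff.2 h, U.ae_servingLoss_pos hshadow] with ω h1 h2
    obtain ⟨k, hk⟩ := exists_nat_one_div_lt (Real.sqrt_pos.2 h2)
    exact h1 k ((Real.lt_sqrt (by positivity)).1 hk)
  simpa using this.exists

/-- The mean number of points of path loss at most `L₀` of an independent copy of the APs is `1`. -/
lemma pathLossRate_mul_lintegral_sqrt_servingLoss [IsProbabilityMeasure P]
    [IsProbabilityMeasure shadow] (hshadow : ∀ᵐ s ∂shadow, 0 < s) (hlam : 0 < lam)
    (U : UplinkNetwork P lam shadow) :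
    pathLossRate lam shadow * ∫⁻ ω, ENNReal.ofReal (√(U.servingLoss ω)) ∂P = 1 := by
  have hK := U.pathLossRate_ne_top hshadow
  set k := (pathLossRate lam shadow).toReal with hk
  have hk0 : 0 < k := ENNReal.toReal_pos (pathLossRate_ne_zero hshadow hlam) hK
  have hKk : pathLossRate lam shadow = ENNReal.ofReal k := (ENNReal.ofReal_toReal hK).symm
  -- The mean of `√L₀` is the integral of its tail `e^(-k t)`, namely `1 / k`.
  rw [lintegral_eq_lintegral_meas_lt P (.of_forall fun ω => Real.sqrt_nonneg _)
    U.measurable_servingLoss.sqrt.aemeasurable]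
  have h : ∀ t ∈ Set.Ioi (0 : ℝ), P {ω | t < √(U.servingLoss ω)} =
      ENNReal.ofReal (Real.exp (-k * t)) := fun t ht => by
    simp only [Real.lt_sqrt (le_of_lt ht)]
    rw [U.measure_sq_lt_servingLoss hshadow (le_of_lt ht), hKk, ← ENNReal.ofReal_mul hk0.le,
      negExp_ofReal (mul_nonneg hk0.le (le_of_lt ht)), neg_mul]
  rw [setLIntegral_congr_fun measurableSet_Ioi h, ← ofReal_integral_eq_lintegral_ofReal
    (integrableOn_exp_mul_Ioi (neg_lt_zero.2 hk0) 0) (.of_forall fun t => (Real.exp_pos _).le),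
    integral_exp_mul_Ioi (neg_lt_zero.2 hk0), hKk, ← ENNReal.ofReal_mul hk0.le]
  simp [hk0.ne']

end UplinkNetwork

/-! ### Exponential fading and the interference exponent -/

lemma expMeasure_one_eq : expMeasure 1 =
    ((volume : Measure ℝ).restrict (Set.Ioi 0)).withDensity
      fun h => ENNReal.ofReal (Real.exp (-h)) := by
  rw [expMeasure, gammaMeasure, restrict_Ioi_eq_restrict_Ici,
    ← withDensity_indicator measurableSet_Ici]
  congr 1
  ext h
  rw [gammaPDF_eq]
  simp only [Set.indicator, Set.mem_Ici]
  split_ifs <;> simp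

lemma lintegral_expMeasure_one {g : ℝ → ℝ≥0∞} (hg : Measurable g) :
    ∫⁻ h, g h ∂expMeasure 1 = ∫⁻ h in Set.Ioi 0, ENNReal.ofReal (Real.exp (-h)) * g h := by
  rw [expMeasure_one_eq, lintegral_withDensity_eq_lintegral_mul _ (by fun_prop) hg]
  rfl

lemma lintegral_one_sub_negExp_expMeasure {c : ℝ} (hc : 0 ≤ c) :
    ∫⁻ h, (1 - negExp (ENNReal.ofReal (c * h))) ∂expMeasure 1 =
      ENNReal.ofReal (c / (1 + c)) := by
  have : IsProbabilityMeasure (expMeasure 1) := isProbabilityMeasure_expMeasure one_pos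
  have hm : Measurable fun h => negExp (ENNReal.ofReal (c * h)) :=
    measurable_negExp.comp (by fun_prop)
  have hc1 : -(1 + c) < 0 := by linarith
  have h : ∫⁻ h, negExp (ENNReal.ofReal (c * h)) ∂expMeasure 1 = ENNReal.ofReal (1 / (1 + c)) := by
    rw [lintegral_expMeasure_one hm]
    have h1 : ∀ h ∈ Set.Ioi (0 : ℝ), ENNReal.ofReal (Real.exp (-h)) *
        negExp (ENNReal.ofReal (c * h)) = ENNReal.ofReal (Real.exp (-(1 + c) * h)) := fun h hh => by
      rw [negExp_ofReal (mul_nonneg hc (le_of_lt hh)), ← ENNReal.ofReal_mul (Real.exp_pos _).le,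
        ← Real.exp_add]
      ring_nf
    rw [setLIntegral_congr_fun measurableSet_Ioi h1, ← ofReal_integral_eq_lintegral_ofReal
      (integrableOn_exp_mul_Ioi hc1 0) (.of_forall fun t => (Real.exp_pos _).le),
      integral_exp_mul_Ioi hc1]
    congr 1
    rw [mul_zero, Real.exp_zero, neg_div_neg_eq]
  rw [lintegral_sub hm (by rw [h]; exact ENNReal.ofReal_ne_top)
    (.of_forall fun _ => negExp_le_one _), h, lintegral_one, measure_univ, ← ENNReal.ofReal_one,
    ← ENNReal.ofReal_sub _ (by positivity)]
  congr 1
  field_simp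
  ring

lemma expMeasure_one_le_ofReal (x : ℝ≥0∞) :
    expMeasure 1 {h | x ≤ ENNReal.ofReal h} = negExp x := by
  have : IsProbabilityMeasure (expMeasure 1) := isProbabilityMeasure_expMeasure one_pos
  rcases eq_or_ne x ∞ with rfl | hx
  · simp
  rcases eq_or_ne x 0 with rfl | h0
  · simp
  obtain ⟨a, ha, rfl⟩ : ∃ a : ℝ, 0 < a ∧ x = ENNReal.ofReal a :=
    ⟨_, ENNReal.toReal_pos h0 hx, (ENNReal.ofReal_toReal hx).symm⟩
  have hs : {h | ENNReal.ofReal a ≤ ENNReal.ofReal h} = Set.Ici a := by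
    ext h
    exact ENNReal.ofReal_le_ofReal_iff' |>.trans ⟨fun h => h.resolve_right ha.not_ge, .inl⟩
  rw [hs, negExp_ofReal ha.le, expMeasure_one_eq, withDensity_apply _ measurableSet_Ici,
    Measure.restrict_restrict measurableSet_Ici,
    Set.inter_eq_left.2 (Set.Ici_subset_Ioi.2 ha), ← restrict_Ioi_eq_restrict_Ici]
  have := integral_exp_mul_Ioi (a := -1) (by norm_num) a
  have hi := integrableOn_exp_mul_Ioi (a := -1) (by norm_num) a
  simp only [neg_mul, one_mul] at this hi
  rw [← ofReal_integral_eq_lintegral_ofReal hi (.of_forall fun t => (Real.exp_pos _).le), this]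
  simp

/-- With `c = √(T l)` the integrand is `c ^ 2 / (c ^ 2 + u ^ 2)`, with primitive `c arctan (u / c)`.
Its increment from `√l` to `∞` is `c (π / 2 - arctan (1 / √T)) = c arctan √T`. -/
lemma lintegral_Ioi_sqrt_eq_covC {T l : ℝ} (hT : 0 < T) (hl : 0 < l) :
    ∫⁻ u in Set.Ioi √l, ENNReal.ofReal (T * l * (u ^ 2)⁻¹ / (1 + T * l * (u ^ 2)⁻¹)) =
      ENNReal.ofReal (√l) * ENNReal.ofReal (covC T) := by
  have hsl : 0 < √l := Real.sqrt_pos.2 hl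
  have hsT : 0 < √T := Real.sqrt_pos.2 hT
  set c := √T * √l with hc
  have hc0 : 0 < c := mul_pos hsT hsl
  have hc2 : T * l = c ^ 2 := by rw [hc, mul_pow, Real.sq_sqrt hT.le, Real.sq_sqrt hl.le]
  have hderiv : ∀ u ∈ Set.Ici √l, HasDerivAt (fun u => c * Real.arctan (u / c))
      (T * l * (u ^ 2)⁻¹ / (1 + T * l * (u ^ 2)⁻¹)) u := fun u hu => by
    have hu0 : 0 < u := hsl.trans_le hu
    have := (((hasDerivAt_id u).div_const c).arctan).const_mul c
    refine this.congr_deriv ?_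
    rw [hc2]
    simp only [id]
    field_simp
    ring
  have hpos : ∀ u ∈ Set.Ioi √l, 0 ≤ T * l * (u ^ 2)⁻¹ / (1 + T * l * (u ^ 2)⁻¹) :=
    fun u _ => by positivity
  have htend : Filter.Tendsto (fun u => c * Real.arctan (u / c)) Filter.atTop
      (nhds (c * (Real.pi / 2))) :=
    ((Real.tendsto_arctan_atTop.mono_right nhdsWithin_le_nhds).comp
      (Filter.tendsto_id.atTop_div_const hc0)).const_mul c
  rw [← ofReal_integral_eq_lintegral_ofReal (integrableOn_Ioi_deriv_of_nonneg' hderiv hpos htend)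
    ((ae_restrict_mem measurableSet_Ioi).mono hpos),
    integral_Ioi_of_hasDerivAt_of_nonneg' hderiv hpos htend, ← ENNReal.ofReal_mul hsl.le]
  congr 1
  have h1 : √l / c = (√T)⁻¹ := by rw [hc]; field_simp
  rw [h1, Real.arctan_inv_of_pos hsT, covC, hc]
  ring

/-- The integrand sees location and shadowing only through the path loss, so these two are traded
for `κ du`. Tonelli then allows averaging over the fading before integrating over `u`. -/
lemma lintegral_interfererIntensity {shadow ν : Measure ℝ} [IsProbabilityMeasure shadow]
    [IsProbabilityMeasure ν] (hshadow : ∀ᵐ s ∂shadow, 0 < s) (hν : ∀ᵐ l ∂ν, 0 < l) (lam : ℝ)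
    {T : ℝ} (hT : 0 < T) :
    ∫⁻ p, (1 - negExp (ENNReal.ofReal T *
        ENNReal.ofReal (p.2.2.1 * p.2.2.2 * (pathLoss p.2.1 p.1 0)⁻¹)))
      ∂interfererIntensity lam shadow ν =
      pathLossRate lam shadow * (∫⁻ l, ENNReal.ofReal (√l) ∂ν) * ENNReal.ofReal (covC T) := by
  have : IsProbabilityMeasure (expMeasure 1) := isProbabilityMeasure_expMeasure one_pos
  -- Arguments: path loss to the typical AP, own loss `l`, fading `h`. The indicator encodes the
  -- association constraint.
  set F : ℝ × ℝ × ℝ → ℝ≥0∞ := {z | z.2.1 ≤ z.1}.indicator fun z =>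
    1 - negExp (ENNReal.ofReal T * ENNReal.ofReal (z.2.1 * z.2.2 * z.1⁻¹)) with hF
  have hFm : Measurable F := by
    refine Measurable.indicator ?_ (measurableSet_le (by fun_prop) (by fun_prop))
    exact measurable_const.sub (measurable_negExp.comp (by fun_prop))
  have hpl : Measurable fun p : Plane × ℝ × ℝ × ℝ => pathLoss p.2.1 p.1 0 :=
    measurable_pathLoss_zero.comp (g := fun p : Plane × ℝ => pathLoss p.2 p.1 0)
      (f := fun p : Plane × ℝ × ℝ × ℝ => (p.1, p.2.1)) (by fun_prop)
  have hS : MeasurableSet {p : Plane × ℝ × ℝ × ℝ | p.2.2.1 ≤ pathLoss p.2.1 p.1 0} :=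
    measurableSet_le (by fun_prop) hpl
  rw [interfererIntensity, ← lintegral_indicator hS,
    ← (measurePreserving_prodAssoc (ENNReal.ofReal lam • (volume : Measure Plane)) shadow
      (ν.prod (expMeasure 1))).lintegral_comp_emb MeasurableEquiv.prodAssoc.measurableEmbedding]
  change ∫⁻ q : (Plane × ℝ) × ℝ × ℝ, F (pathLoss q.1.2 q.1.1 0, q.2) ∂_ = _
  have hinner : ∀ l : ℝ, 0 < l → ∫⁻ h, (∫⁻ u in Set.Ioi 0, F (u ^ 2, l, h)) ∂expMeasure 1 =
      ENNReal.ofReal (√l) * ENNReal.ofReal (covC T) := fun l hl => by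
    rw [lintegral_lintegral_swap (f := fun h u => F (u ^ 2, l, h))
        (hFm.comp (f := fun w : ℝ × ℝ => (w.2 ^ 2, l, w.1)) (by fun_prop)).aemeasurable,
      ← lintegral_Ioi_sqrt_eq_covC hT hl, restrict_Ioi_eq_restrict_Ici (a := √l),
      ← lintegral_indicator measurableSet_Ici]
    rw [← lintegral_indicator measurableSet_Ioi]
    refine lintegral_congr fun u => ?_
    by_cases hu : √l ≤ u
    · have hu0 : 0 < u := (Real.sqrt_pos.2 hl).trans_le hu
      have hlu : l ≤ u ^ 2 := (Real.sqrt_le_left hu0.le).1 hu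
      rw [Set.indicator_of_mem (show u ∈ Set.Ioi 0 from hu0),
        Set.indicator_of_mem (show u ∈ Set.Ici √l from hu),
        ← lintegral_one_sub_negExp_expMeasure (by positivity)]
      refine lintegral_congr fun h => ?_
      rw [hF, Set.indicator_of_mem (show (u ^ 2, l, h) ∈ {z : ℝ × ℝ × ℝ | z.2.1 ≤ z.1} from hlu),
        ← ENNReal.ofReal_mul hT.le]
      ring_nf
    · rw [Set.indicator_of_notMem (show u ∉ Set.Ici √l from hu)]
      by_cases hu0 : 0 < u
      · have hlu : ¬ l ≤ u ^ 2 := fun h => hu ((Real.sqrt_le_left hu0.le).2 h)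
        rw [Set.indicator_of_mem (show u ∈ Set.Ioi 0 from hu0)]
        refine (lintegral_congr fun h => ?_).trans lintegral_zero
        exact Set.indicator_of_notMem (s := {z : ℝ × ℝ × ℝ | z.2.1 ≤ z.1}) hlu _
      · exact Set.indicator_of_notMem hu0 _
  calc ∫⁻ q : (Plane × ℝ) × ℝ × ℝ, F (pathLoss q.1.2 q.1.1 0, q.2)
        ∂((ENNReal.ofReal lam • (volume : Measure Plane)).prod shadow).prod (ν.prod (expMeasure 1))
      = ∫⁻ z, ∫⁻ p, F (pathLoss p.2 p.1 0, z)
          ∂((ENNReal.ofReal lam • (volume : Measure Plane)).prod shadow) ∂ν.prod (expMeasure 1) :=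
        lintegral_prod_symm' (fun q : (Plane × ℝ) × ℝ × ℝ => F (pathLoss q.1.2 q.1.1 0, q.2))
          (hFm.comp ((measurable_pathLoss_zero.comp measurable_fst).prodMk measurable_snd))
    _ = ∫⁻ z, pathLossRate lam shadow * (∫⁻ u in Set.Ioi 0, F (u ^ 2, z)) ∂ν.prod (expMeasure 1) :=
        lintegral_congr fun z => lintegral_comp_pathLoss hshadow lam
          (g := fun r => F (r, z)) (hFm.comp (by fun_prop))
    _ = pathLossRate lam shadow *
          ∫⁻ l, ∫⁻ h, (∫⁻ u in Set.Ioi 0, F (u ^ 2, l, h)) ∂expMeasure 1 ∂ν := by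
        have hm : Measurable fun z : ℝ × ℝ => ∫⁻ u in Set.Ioi 0, F (u ^ 2, z) :=
          Measurable.lintegral_prod_right' (f := fun w : (ℝ × ℝ) × ℝ => F (w.2 ^ 2, w.1))
            (hFm.comp (f := fun w : (ℝ × ℝ) × ℝ => (w.2 ^ 2, w.1)) (by fun_prop))
        rw [lintegral_const_mul _ hm, lintegral_prod _ hm.aemeasurable]
    _ = pathLossRate lam shadow *
          ∫⁻ l, ENNReal.ofReal (√l) * ENNReal.ofReal (covC T) ∂ν := by
        rw [lintegral_congr_ae (hν.mono hinner)]
    _ = _ := by rw [lintegral_mul_const _ (by fun_prop), mul_assoc]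

/-! ### From delay to coverage -/

/-- The two half payloads add up to `q / r`. The computation stays in `ℝ≥0∞`, so `r = 0` and `r = ∞`
need no separate treatment. -/
lemma cloudDelay_self_le_iff {q dc dt : ℝ} (hdc : 0 ≤ dc) (hdt : dc < dt) (r : ℝ≥0∞) :
    cloudDelay q dc r r ≤ ENNReal.ofReal dt ↔
      ENNReal.ofReal q ≤ ENNReal.ofReal (dt - dc) * r := by
  have h1 : ENNReal.ofReal q / (2 * r) = ENNReal.ofReal q / r / 2 := by
    rw [div_eq_mul_inv, div_eq_mul_inv, div_eq_mul_inv,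
      ENNReal.mul_inv (.inl two_ne_zero) (.inl ENNReal.ofNat_ne_top), mul_comm 2⁻¹, mul_assoc]
  have hd : ENNReal.ofReal (dt - dc) ≠ 0 := by simpa using hdt
  rw [cloudDelay, h1, ENNReal.add_halves, ← ENNReal.div_le_iff_le_mul (.inr ENNReal.ofReal_ne_top)
    (.inr hd), ENNReal.ofReal_sub _ hdc]
  exact (ENNReal.le_sub_iff_add_le_right ENNReal.ofReal_ne_top
    (ENNReal.ofReal_le_ofReal hdt.le)).symm

lemma ofReal_le_log_div_log_two_iff (x : ℝ) (s : ℝ≥0∞) :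
    ENNReal.ofReal x ≤ (ENNReal.log (1 + s)).toENNReal / ENNReal.ofReal (Real.log 2) ↔
      ENNReal.ofReal (rateT x) ≤ s := by
  have hlog2 : 0 < Real.log 2 := Real.log_pos one_lt_two
  rcases eq_or_ne s ∞ with rfl | hs
  · simp [ENNReal.top_div]
  obtain ⟨σ, hσ, rfl⟩ : ∃ σ : ℝ, 0 ≤ σ ∧ s = ENNReal.ofReal σ :=
    ⟨_, ENNReal.toReal_nonneg, (ENNReal.ofReal_toReal hs).symm⟩
  rw [← ENNReal.ofReal_one, ← ENNReal.ofReal_add zero_le_one hσ,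
    ENNReal.log_ofReal_of_pos (by positivity), EReal.toENNReal_of_ne_top (EReal.coe_ne_top _),
    EReal.toReal_coe, ← ENNReal.ofReal_div_of_pos hlog2, ENNReal.ofReal_le_ofReal_iff
    (div_nonneg (Real.log_nonneg (by linarith)) hlog2.le), ENNReal.ofReal_le_ofReal_iff hσ,
    le_div_iff₀ hlog2, ← Real.log_rpow two_pos, Real.log_le_log_iff (by positivity) (by positivity),
    rateT, sub_le_iff_le_add']

lemma rateT_pos {x : ℝ} (hx : 0 < x) : 0 < rateT x :=
  sub_pos.2 (Real.one_lt_rpow one_lt_two hx)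

lemma covC_nonneg (x : ℝ) : 0 ≤ covC x :=
  mul_nonneg (Real.sqrt_nonneg x) (Real.arctan_nonneg.2 (Real.sqrt_nonneg x))

/-- The delay event itself need not be measurable; replacing it by `A` up to a null set is enough
for both indicators. -/
lemma averageMSE_eq_of_ae {Ω : Type*} [MeasurableSpace Ω] {P : Measure Ω} [IsProbabilityMeasure P]
    {D : Ω → ℝ≥0∞} {dt : ℝ} {A : Set Ω} (hA : MeasurableSet A)
    (hDA : ∀ᵐ ω ∂P, D ω ≤ ENNReal.ofReal dt ↔ ω ∈ A) (mc md : ℝ) :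
    averageMSE P D dt mc md = md - (md - mc) * P.real A := by
  have h1 : ∫ ω, {ω | D ω ≤ ENNReal.ofReal dt}.indicator (fun _ => mc) ω ∂P = P.real A * mc := by
    rw [← smul_eq_mul, ← integral_indicator_const mc hA]
    exact integral_congr_ae (indicator_ae_eq_of_ae_eq_set (Filter.eventuallyEq_set.2 hDA))
  have h2 : ∫ ω, {ω | ENNReal.ofReal dt < D ω}.indicator (fun _ => md) ω ∂P =
      (1 - P.real A) * md := by
    rw [← probReal_compl_eq_one_sub hA, ← smul_eq_mul, ← integral_indicator_const md hA.compl]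
    exact integral_congr_ae (indicator_ae_eq_of_ae_eq_set (Filter.eventuallyEq_set.2
      (hDA.mono fun ω hω => not_le.symm.trans (not_congr hω))))
  rw [averageMSE, h1, h2]
  ring

/-- Coverage by an exponentially distributed `H`, independent of `Y`. -/
lemma measure_le_ofReal_of_expMeasure {Ω F : Type*} [MeasurableSpace Ω] [MeasurableSpace F]
    {P : Measure Ω} [IsProbabilityMeasure P] {H : Ω → ℝ} {Y : Ω → F}
    (hH : HasLaw H (expMeasure 1) P) (hY : Measurable Y) (hind : IndepFun H Y P)
    {G : F → ℝ≥0∞} (hG : Measurable G) :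
    P {ω | G (Y ω) ≤ ENNReal.ofReal (H ω)} = ∫⁻ ω, negExp (G (Y ω)) ∂P := by
  have : IsProbabilityMeasure (expMeasure 1) := isProbabilityMeasure_expMeasure one_pos
  have : IsProbabilityMeasure (P.map Y) := Measure.isProbabilityMeasure_map hY.aemeasurable
  have hS : MeasurableSet {z : ℝ × F | G z.2 ≤ ENNReal.ofReal z.1} :=
    measurableSet_le (hG.comp measurable_snd) (by fun_prop)
  have hprod := (indepFun_iff_map_prod_eq_prod_map_map hH.aemeasurable hY.aemeasurable).1 hind
  rw [hH.map_eq] at hprod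
  have h := Measure.map_apply_of_aemeasurable (hH.aemeasurable.prodMk hY.aemeasurable) hS
  rw [hprod, Measure.prod_apply_symm hS] at h
  refine h.symm.trans ?_
  rw [← lintegral_map (f := fun y => negExp (G y)) (measurable_negExp.comp hG) hY]
  exact lintegral_congr fun y => expMeasure_one_le_ofReal (G y)

lemma ae_pos_of_hasLaw_expMeasure {Ω : Type*} [MeasurableSpace Ω] {P : Measure Ω} {H : Ω → ℝ}
    (hH : HasLaw H (expMeasure 1) P) : ∀ᵐ ω ∂P, 0 < H ω := by
  rw [hH.ae_iff (p := fun x => 0 < x) (measurable_const.lt measurable_id), expMeasure_one_eq]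
  exact (withDensity_absolutelyContinuous _ _).ae_le (ae_restrict_mem measurableSet_Ioi)

namespace UplinkNetwork

variable {Ω : Type*} [MeasurableSpace Ω] {P : Measure Ω} {lam : ℝ} {shadow : Measure ℝ}

/-- The marked interfering devices, seen from the serving AP. -/
def markedDev (U : UplinkNetwork P lam shadow) (n : ℕ) (ω : Ω) : Plane × ℝ × ℝ × ℝ :=
  (U.dev n ω - U.ap (U.serving ω) ω, U.devShadow n ω, U.devLoss n ω, U.devFading n ω)

lemma interference_eq (U : UplinkNetwork P lam shadow) (ω : Ω) :
    U.interference ω = ∑' n, ENNReal.ofReal ((U.markedDev n ω).2.2.1 * (U.markedDev n ω).2.2.2 *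
      (pathLoss (U.markedDev n ω).2.1 (U.markedDev n ω).1 0)⁻¹) := by
  simp only [interference, markedDev, servingAP, pathLoss, sub_zero]

lemma measurable_interferencePower : Measurable fun p : Plane × ℝ × ℝ × ℝ =>
    ENNReal.ofReal (p.2.2.1 * p.2.2.2 * (pathLoss p.2.1 p.1 0)⁻¹) := by
  unfold pathLoss
  fun_prop

lemma measurable_interference (U : UplinkNetwork P lam shadow) : Measurable U.interference := by
  simp_rw [funext U.interference_eq]
  exact Measurable.tsum fun n => measurable_interferencePower.comp (U.dev_poisson.measurable n)

/-- Uplink coverage probability without thermal noise. -/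
theorem measure_mul_interference_le [IsProbabilityMeasure P] [IsProbabilityMeasure shadow]
    (hshadow : ∀ᵐ s ∂shadow, 0 < s) (hlam : 0 < lam) (U : UplinkNetwork P lam shadow) {T : ℝ}
    (hT : 0 < T) :
    P {ω | ENNReal.ofReal T * U.interference ω ≤ ENNReal.ofReal (U.fading ω)} =
      ENNReal.ofReal (Real.exp (-covC T)) := by
  set f : Plane × ℝ × ℝ × ℝ → ℝ≥0∞ := fun p => ENNReal.ofReal T *
    ENNReal.ofReal (p.2.2.1 * p.2.2.2 * (pathLoss p.2.1 p.1 0)⁻¹)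
  have hfm : Measurable f := measurable_interferencePower.const_mul _
  have hG : Measurable fun Y : ℕ → Plane × ℝ × ℝ × ℝ => ∑' n, f (Y n) :=
    Measurable.tsum fun n => hfm.comp (measurable_pi_apply n)
  have hY : Measurable fun ω n => U.markedDev n ω :=
    measurable_pi_lambda _ U.dev_poisson.measurable
  have hm := U.measurable_servingLoss
  have : IsProbabilityMeasure (P.map U.servingLoss) :=
    Measure.isProbabilityMeasure_map hm.aemeasurable
  have hν : ∀ᵐ l ∂P.map U.servingLoss, 0 < l :=
    (ae_map_iff hm.aemeasurable measurableSet_Ioi).2 (U.ae_servingLoss_pos hshadow)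
  have h1 := measure_le_ofReal_of_expMeasure U.fading_law hY U.fading_indep hG
  have h2 := U.dev_poisson.lintegral_negExp_tsum hfm
  have h3 := lintegral_interfererIntensity hshadow hν lam hT
  -- Here `κ E[√L₀] = 1` removes density and shadowing from the exponent.
  rw [lintegral_map (by fun_prop) hm, U.pathLossRate_mul_lintegral_sqrt_servingLoss hshadow hlam,
    one_mul] at h3
  simp_rw [interference_eq, ← ENNReal.tsum_mul_left]
  refine h1.trans (h2.trans ?_)
  rw [← negExp_ofReal (covC_nonneg T), ← h3]
  rfl

lemma ae_cloudDelay_le_iff (U : UplinkNetwork P lam shadow) {b q dt dc N : ℝ} (hb : 0 < b)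
    (hq : 0 < q) (hdc : 0 ≤ dc) (hdt : dc < dt) (hN : 0 < N) {load : Ω → ℝ}
    (hload : ∀ᵐ ω ∂P, load ω = N) {rateDown : Ω → ℝ≥0∞}
    (hrate : ∀ᵐ ω ∂P, rateDown ω = U.rate ∞ b load ω) :
    ∀ᵐ ω ∂P, cloudDelay q dc (U.rate ∞ b load ω) (rateDown ω) ≤ ENNReal.ofReal dt ↔
      ENNReal.ofReal (rateT (N * inferenceRate q b dt dc)) * U.interference ω ≤
        ENNReal.ofReal (U.fading ω) := by
  have hd : 0 < dt - dc := sub_pos.2 hdt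
  have hx : 0 < N * inferenceRate q b dt dc := by unfold inferenceRate; positivity
  filter_upwards [hload, hrate, ae_pos_of_hasLaw_expMeasure U.fading_law] with ω h1 h2 h3
  have hc : 0 < (dt - dc) * (b / N) := by positivity
  have hqx : ENNReal.ofReal q = ENNReal.ofReal ((dt - dc) * (b / N)) *
      ENNReal.ofReal (N * inferenceRate q b dt dc) := by
    rw [← ENNReal.ofReal_mul hc.le, inferenceRate]
    congr 1
    field_simp
  rw [h2, cloudDelay_self_le_iff hdc hdt, rate, h1, ← mul_assoc, ← ENNReal.ofReal_mul hd.le, hqx,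
    ENNReal.mul_le_mul_iff_right (by simpa using hc) ENNReal.ofReal_ne_top,
    ofReal_le_log_div_log_two_iff _, sinr, ENNReal.inv_top, zero_add]
  -- The interference may be `0` or `∞`; clearing the denominator is legitimate because `0 < H < ∞`.
  exact ENNReal.le_div_iff_mul_le (.inr (by simpa using h3)) (.inr ENNReal.ofReal_ne_top)

end UplinkNetwork

theorem lemma2 {Ω Θ : Type*} [MeasurableSpace Ω] [MeasurableSpace Θ]
    (P : Measure Ω) [IsProbabilityMeasure P]
    (Q : Measure Θ) [IsProbabilityMeasure Q]
    (lam lamu b q dt dc : ℝ) (hlam : 0 < lam) (hlamu : 0 < lamu) (hb : 0 < b) (hq : 0 < q)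
    (hdc : 0 ≤ dc) (hdt : dc < dt)
    (shadow : Measure ℝ) [IsProbabilityMeasure shadow] (hshadow : ∀ᵐ s ∂shadow, 0 < s)
    (U : UplinkNetwork P lam shadow)
    (snr : ℝ≥0∞) (hsnr : snr = ∞)
    (load : Ω → ℝ) (hload : ∀ᵐ ω ∂P, load ω = avgLoad lam lamu)
    (rateDown : Ω → ℝ≥0∞) (hrate : ∀ᵐ ω ∂P, rateDown ω = U.rate snr b load ω)
    (y yd yc : Θ → ℝ) (hyd : MemLp (fun θ => y θ - yd θ) 2 Q)
    (hyc : MemLp (fun θ => y θ - yc θ) 2 Q) (hle : mse Q y yc ≤ mse Q y yd) :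
    let mc := mse Q y yc
    let md := mse Q y yd
    let D : Ω → ℝ≥0∞ := fun ω => cloudDelay q dc (U.rate snr b load ω) (rateDown ω)
    let m := averageMSE P D dt mc md
    m = md - (md - mc) *
        Real.exp (-covC (rateT (avgLoad lam lamu * inferenceRate q b dt dc))) ∧
      mc ≤ m ∧ m ≤ md := by
  intro mc md D m
  subst hsnr
  have hN : 0 < avgLoad lam lamu := by unfold avgLoad; positivity
  have hT : 0 < rateT (avgLoad lam lamu * inferenceRate q b dt dc) := by
    have : 0 < dt - dc := sub_pos.2 hdt
    exact rateT_pos (by unfold inferenceRate; positivity)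
  set T := rateT (avgLoad lam lamu * inferenceRate q b dt dc)
  have hH := U.fading_law.aemeasurable
  -- A law gives the fading only almost everywhere measurability, so a measurable version defines
  -- the event.
  set A := {ω | ENNReal.ofReal T * U.interference ω ≤ ENNReal.ofReal (hH.mk U.fading ω)} with hAdef
  have hA : MeasurableSet A := measurableSet_le (U.measurable_interference.const_mul _)
    hH.measurable_mk.ennreal_ofReal
  have hDA : ∀ᵐ ω ∂P, D ω ≤ ENNReal.ofReal dt ↔ ω ∈ A := by
    filter_upwards [U.ae_cloudDelay_le_iff hb hq hdc hdt hN hload hrate, hH.ae_eq_mk] with ω h1 h2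
    rw [hAdef, Set.mem_ofPred_eq, ← h2]
    exact h1
  have hPA : P.real A = Real.exp (-covC T) := by
    have h : P A = P {ω | ENNReal.ofReal T * U.interference ω ≤ ENNReal.ofReal (U.fading ω)} := by
      refine measure_congr ?_
      filter_upwards [hH.ae_eq_mk] with ω h2
      change (_ ≤ ENNReal.ofReal (hH.mk U.fading ω)) = (_ ≤ _)
      rw [← h2]
    rw [measureReal_def, h, U.measure_mul_interference_le hshadow hlam hT,
      ENNReal.toReal_ofReal (Real.exp_pos _).le]
  have hm : m = md - (md - mc) * Real.exp (-covC T) := by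
    rw [← hPA]
    exact averageMSE_eq_of_ae hA hDA mc md
  have he0 : 0 < Real.exp (-covC T) := Real.exp_pos _
  have he1 : Real.exp (-covC T) ≤ 1 := Real.exp_le_one_iff.2 (neg_nonpos.2 (covC_nonneg T))
  have hmd : 0 ≤ md - mc := sub_nonneg.2 hle
  exact ⟨hm, by nlinarith, by nlinarith⟩
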